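/- Let $p$ be an odd prime, let $1\le m_1<m_2<\cdots$ be integers, and for $n\ge 0$ let $T_n$ be the spherically homogeneous rooted tree in which every vertex of level $i-1$ has $p^{m_{n+i}}$ children ($i\ge 1$), the children being labelled by $1,\dots,p^{m_{n+i}}$; write $T=T_0$. Sending an automorphism that fixes the first level of $T_n$ to the tuple of its actions on the $p^{m_{n+1}}$ first-level subtrees gives an isomorphism $$\psi_1\colon \mathrm{St}_{\mathrm{Aut}\,T_n}(1)\to \mathrm{Aut}\,T_{n+1}\times\overset{p^{m_{n+1}}}{\cdots}\times \mathrm{Aut}\,T_{n+1}.$$ Let $\mathbf e=(e_1,\dots,e_{p^{m_1}-1})$ with $e_i\in\{0,\pm1,\dots,\pm(p^{m_2}-1)\}$. Let $a_n\in\mathrm{Aut}\,T_n$ be the rooted automorphism which permutes the first-level subtrees rigidly according to the cycle $(1\,2\,\cdots\,p^{m_{n+1}})$, let $b_n\in \mathrm{St}_{\mathrm{Aut}\,T_n}(1)$ be defined recursively by $$\psi_1(b_0)=(a_1^{e_1},\dots,a_1^{e_{p^{m_1}-1}},b_1),\qquad \psi_1(b_n)=(a_{n+1}^{e_1},\dots,a_{n+1}^{e_{p^{m_1}-1}},1,\overset{p^{m_{n+1}}-p^{m_1}}{\dots},1,b_{n+1})\quad(n\ge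 1),$$ and put $G_n=\langle a_n,b_n\rangle\le\mathrm{Aut}\,T_n$ and $G=G_0$ (the growing GGS-group defined by $\mathbf e$). Suppose that $\mathbf e$ is non-zero modulo $p$ (not all $e_i$ are divisible by $p$) and non-constant modulo $p$ (the $e_i$ are not all congruent modulo $p$), and that for all $n\ge 1$ $$\psi_1(G_{n-1}')\ge G_n'\times\overset{p^{m_n}}{\cdots}\times G_n'.$$ Then $\mathrm{Aut}\,G=N_{\mathrm{Aut}\,T}(G)$; that is, the homomorphism $N_{\mathrm{Aut}\,T}(G)\to\mathrm{Aut}\,G$ given by conjugation is bijective: every automorphism of $G$ is induced by conjugation by exactly one element of $\mathrm{Aut}\,T$ normalising $G$. -/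

import Mathlib

/-- Fix a sequence `d` of degrees. `Vertex d n` is the vertex set of the rooted tree `T_n` in which
every vertex of level `k` has `d (n + k)` children: a vertex is a finite word whose `k`-th letter
lies in `Fin (d (n + k))`. The tree `T` itself is `Vertex d 0`, and `T_n` is the subtree of `T`
hanging from a vertex of level `n`. -/
inductive Vertex (d : ℕ → ℕ) : ℕ → Type
  | root {n : ℕ} : Vertex d n
  | cons {n : ℕ} (x : Fin (d n)) (u : Vertex d (n + 1)) : Vertex d n

namespace Vertex

variable {d : ℕ → ℕ}

/-- `u` is a prefix of `v`. -/
def IsPrefix : {n : ℕ} → Vertex d n → Vertex d n → Prop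
  | _, root, _ => True
  | _, cons _ _, root => False
  | _, cons x u, cons y v => x = y ∧ IsPrefix u v

theorem isPrefix_refl : {n : ℕ} → (u : Vertex d n) → IsPrefix u u
  | _, root => trivial
  | _, cons _ u => ⟨rfl, isPrefix_refl u⟩

theorem isPrefix_trans : {n : ℕ} → (u v w : Vertex d n) →
    IsPrefix u v → IsPrefix v w → IsPrefix u w
  | _, root, _, _, _, _ => trivial
  | _, cons _ _, cons _ _, cons _ _, h, k =>
      ⟨h.1.trans k.1, isPrefix_trans _ _ _ h.2 k.2⟩

theorem isPrefix_antisymm : {n : ℕ} → (u v : Vertex d n) →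
    IsPrefix u v → IsPrefix v u → u = v
  | _, root, root, _, _ => rfl
  | _, cons _ _, cons _ _, h, k => by
      rw [h.1, isPrefix_antisymm _ _ h.2 k.2]

/-- The prefix order on the vertices. The root is the least vertex, and `v` covers `u` exactly when
`v` is `u` followed by one more letter, that is, when `v` is a child of `u`. -/
instance instPartialOrder (n : ℕ) : PartialOrder (Vertex d n) where
  le := IsPrefix
  le_refl := isPrefix_refl
  le_trans := isPrefix_trans
  le_antisymm := isPrefix_antisymm

theorem root_le {n : ℕ} (u : Vertex d n) : root ≤ u := trivial

theorem cons_le_root {n : ℕ} {x : Fin (d n)} {u : Vertex d (n + 1)} :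
    ¬ cons x u ≤ root := fun h => h

theorem cons_le_cons {n : ℕ} {x y : Fin (d n)} {u v : Vertex d (n + 1)} :
    cons x u ≤ cons y v ↔ x = y ∧ u ≤ v := Iff.rfl

theorem le_root {n : ℕ} {u : Vertex d n} (h : u ≤ root) : u = root :=
  le_antisymm h (root_le u)

theorem cons_root_le {n : ℕ} {x : Fin (d n)} {v : Vertex d n}
    (h : cons x root ≤ v) : ∃ u, v = cons x u := by
  cases v with
  | root => exact absurd h cons_le_root
  | cons y u => exact ⟨u, by rw [(cons_le_cons.1 h).1]⟩

end Vertex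

/-- The automorphism group of the rooted tree `T_n`. An automorphism of a rooted tree is the same as
an automorphism of the prefix order on its vertices. -/
abbrev AutTree (d : ℕ → ℕ) (n : ℕ) : Type := Vertex d n ≃o Vertex d n

namespace AutTree

open Vertex

variable {d : ℕ → ℕ} {n : ℕ}

theorem map_root (f : AutTree d n) : f root = root :=
  le_root ((f.le_symm_apply).1 (root_le _))

/-- The first level stabiliser `St_{Aut T_n}(1)`. -/
def levelStab (d : ℕ → ℕ) (n : ℕ) : Subgroup (AutTree d n) where
  carrier := {f | ∀ x : Fin (d n), f (cons x root) = cons x root}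
  one_mem' := fun _ => rfl
  mul_mem' := by
    intro f g hf hg x
    change f (g (cons x root)) = _
    rw [hg x, hf x]
  inv_mem' := by
    intro f hf x
    change f.symm (cons x root) = _
    rw [OrderIso.symm_apply_eq, hf x]

theorem exists_section (f : levelStab d n) (x : Fin (d n)) (u : Vertex d (n + 1)) :
    ∃ v, f.1 (cons x u) = cons x v := by
  apply cons_root_le
  have h : f.1 (cons x root) ≤ f.1 (cons x u) :=
    f.1.le_iff_le.2 ⟨rfl, root_le u⟩
  rwa [f.2 x] at h

/-- The map `u ↦ v` on `T_{n+1}` determined by `f (x u) = x v`. -/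
noncomputable def sectionFun (f : levelStab d n) (x : Fin (d n)) (u : Vertex d (n + 1)) :
    Vertex d (n + 1) :=
  (exists_section f x u).choose

theorem cons_sectionFun (f : levelStab d n) (x : Fin (d n)) (u : Vertex d (n + 1)) :
    f.1 (cons x u) = cons x (sectionFun f x u) :=
  (exists_section f x u).choose_spec

theorem sectionFun_eq {f : levelStab d n} {x : Fin (d n)} {u v : Vertex d (n + 1)}
    (h : f.1 (cons x u) = cons x v) : sectionFun f x u = v := by
  rw [cons_sectionFun] at h
  injection h

theorem sectionFun_mul (f g : levelStab d n) (x : Fin (d n)) (u : Vertex d (n + 1)) :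
    sectionFun (f * g) x u = sectionFun f x (sectionFun g x u) := by
  apply sectionFun_eq
  change f.1 (g.1 (cons x u)) = _
  rw [cons_sectionFun, cons_sectionFun]

theorem sectionFun_one (x : Fin (d n)) (u : Vertex d (n + 1)) :
    sectionFun (1 : levelStab d n) x u = u :=
  sectionFun_eq rfl

/-- The section of `f ∈ St(1)` at the first-level vertex `x`. -/
noncomputable def sectionAt (f : levelStab d n) (x : Fin (d n)) : AutTree d (n + 1) where
  toFun := sectionFun f x
  invFun := sectionFun f⁻¹ x
  left_inv := fun u => by rw [← sectionFun_mul, inv_mul_cancel, sectionFun_one]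
  right_inv := fun u => by rw [← sectionFun_mul, mul_inv_cancel, sectionFun_one]
  map_rel_iff' := by
    intro u v
    change sectionFun f x u ≤ sectionFun f x v ↔ _
    have h := f.1.le_iff_le (x := cons x u) (y := cons x v)
    rw [cons_sectionFun, cons_sectionFun, cons_le_cons, cons_le_cons] at h
    simpa using h

/-- The action on words `x u ↦ x (g x u)`. -/
def ofSectionsFun (g : Fin (d n) → AutTree d (n + 1)) : Vertex d n → Vertex d n
  | root => root
  | cons x u => cons x (g x u)

/-- The automorphism in `St(1)` with prescribed sections at the first level. -/
def ofSections (g : Fin (d n) → AutTree d (n + 1)) : levelStab d n where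
  val :=
    { toFun := ofSectionsFun g
      invFun := ofSectionsFun (fun x => (g x).symm)
      left_inv := by rintro (_ | ⟨x, u⟩) <;> simp [ofSectionsFun]
      right_inv := by rintro (_ | ⟨x, u⟩) <;> simp [ofSectionsFun]
      map_rel_iff' := by
        rintro (_ | ⟨x, u⟩) (_ | ⟨y, v⟩)
        · exact Iff.rfl
        · exact ⟨fun _ => root_le _, fun _ => root_le _⟩
        · exact Iff.rfl
        · change (x = y ∧ g x u ≤ g y v) ↔ (x = y ∧ u ≤ v)
          constructor <;> rintro ⟨rfl, h⟩ <;> simpa using h }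
  property := fun x => by
    change cons x (g x root) = _
    rw [map_root]

/-- The isomorphism `ψ_1 : St_{Aut T_n}(1) → Aut T_{n+1} × ⋯ × Aut T_{n+1}` which decomposes an
automorphism into its sections at the first-level vertices. -/
noncomputable def psi (d : ℕ → ℕ) (n : ℕ) :
    levelStab d n ≃* (Fin (d n) → AutTree d (n + 1)) where
  toFun := sectionAt
  invFun := ofSections
  left_inv := by
    intro f
    apply Subtype.ext
    apply RelIso.ext
    rintro (_ | ⟨x, u⟩)
    · exact (map_root f.1).symm
    · exact (cons_sectionFun f x u).symm
  right_inv := by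
    intro g
    funext x
    apply RelIso.ext
    intro u
    exact sectionFun_eq rfl
  map_mul' := by
    intro f g
    funext x
    apply RelIso.ext
    intro u
    exact sectionFun_mul f g x u

/-- The action on words `x u ↦ σ(x) u`. -/
def rootedFun (σ : Equiv.Perm (Fin (d n))) : Vertex d n → Vertex d n
  | root => root
  | cons x u => cons (σ x) u

/-- The rooted automorphism of `T_n` that permutes the subtrees hanging from the root rigidly
according to `σ`. -/
def rooted (σ : Equiv.Perm (Fin (d n))) : AutTree d n where
  toFun := rootedFun σ
  invFun := rootedFun σ.symm
  left_inv := by rintro (_ | ⟨x, u⟩) <;> simp [rootedFun]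
  right_inv := by rintro (_ | ⟨x, u⟩) <;> simp [rootedFun]
  map_rel_iff' := by
    rintro (_ | ⟨x, u⟩) (_ | ⟨y, v⟩)
    · exact Iff.rfl
    · exact ⟨fun _ => root_le _, fun _ => root_le _⟩
    · exact Iff.rfl
    · change (σ x = σ y ∧ u ≤ v) ↔ (x = y ∧ u ≤ v)
      simp

/-- The action on words, by recursion, of the directed automorphism below. -/
def directedFun (s : ∀ n, Fin (d n) → AutTree d (n + 1)) : {n : ℕ} → Vertex d n → Vertex d n
  | _, root => root
  | n, cons x u => if x.val + 1 = d n then cons x (directedFun s u) else cons x (s n x u)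

theorem directedFun_inv (s t : ∀ n, Fin (d n) → AutTree d (n + 1))
    (h : ∀ n x u, s n x (t n x u) = u) :
    {n : ℕ} → (u : Vertex d n) → directedFun s (directedFun t u) = u
  | _, root => rfl
  | n, cons x u => by
      by_cases hx : x.val + 1 = d n
      · simp [directedFun, hx, directedFun_inv s t h u]
      · simp [directedFun, hx, h]

theorem directedFun_mono (s : ∀ n, Fin (d n) → AutTree d (n + 1)) :
    {n : ℕ} → (u v : Vertex d n) → u ≤ v → directedFun s u ≤ directedFun s v
  | _, root, _, _ => root_le _
  | n, cons x u, cons y v, h => by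
      obtain ⟨rfl, huv⟩ := cons_le_cons.1 h
      by_cases hx : x.val + 1 = d n
      · simpa [directedFun, hx, cons_le_cons] using directedFun_mono s u v huv
      · simpa [directedFun, hx, cons_le_cons] using huv

/-- The automorphisms `b_n ∈ St_{Aut T_n}(1)` determined by the recursion that the section of `b_n`
at the last letter of `Fin (d n)` is `b_{n+1}`, and the section at any other letter `x` is
`s n x`. -/
def directed (s : ∀ n, Fin (d n) → AutTree d (n + 1)) (n : ℕ) : AutTree d n where
  toFun := directedFun s
  invFun := directedFun (fun n x => (s n x).symm)
  left_inv := directedFun_inv _ _ (by simp)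
  right_inv := directedFun_inv _ _ (by simp)
  map_rel_iff' := by
    intro u v
    refine ⟨fun h => ?_, directedFun_mono s u v⟩
    have := directedFun_mono (fun n x => (s n x).symm) _ _ h
    change directedFun _ (directedFun s u) ≤ directedFun _ (directedFun s v) at this
    rwa [directedFun_inv _ _ (by simp), directedFun_inv _ _ (by simp)] at this

theorem directed_mem (s : ∀ n, Fin (d n) → AutTree d (n + 1)) (n : ℕ) :
    directed s n ∈ levelStab d n := by
  intro x
  change directedFun s (cons x root) = _
  by_cases hx : x.val + 1 = d n
  · simp [directedFun, hx]
  · simp [directedFun, hx, map_root]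

theorem psi_directed (s : ∀ n, Fin (d n) → AutTree d (n + 1)) (n : ℕ) :
    psi d n ⟨directed s n, directed_mem s n⟩ =
      fun x => if x.val + 1 = d n then directed s (n + 1) else s n x := by
  funext x
  apply RelIso.ext
  intro u
  apply sectionFun_eq
  change directedFun s (cons x u) = _
  by_cases hx : x.val + 1 = d n
  · simp only [directedFun, hx, if_true]
    rfl
  · simp only [directedFun, hx, if_false]

end AutTree

/-! ### Growing GGS-groups

The exponents `m_1 < m_2 < ⋯` are `m 0 < m 1 < ⋯`, the letters `1, …, p ^ m_i` are
`0, …, p ^ m_i - 1`, and the entries `e_1, …, e_{p ^ m_1 - 1}` of the defining vector are indexed by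
`0, …, p ^ m_1 - 2`. -/

namespace GrowingGGS

/-- The degrees `p ^ m_1, p ^ m_2, …`. -/
abbrev deg (p : ℕ) (m : ℕ → ℕ) : ℕ → ℕ := fun i => p ^ m i

/-- The rooted automorphism `a_n` of `T_n` given by the cycle `(1 2 ⋯ p ^ m_{n+1})`. -/
def a (p : ℕ) (m : ℕ → ℕ) (n : ℕ) : AutTree (deg p m) n :=
  AutTree.rooted (finRotate (deg p m n))

/-- The directed automorphism `b_n` of `T_n`, with
`ψ_1(b_n) = (a_{n+1} ^ e_1, …, a_{n+1} ^ e_{p ^ m_1 - 1}, 1, …, 1, b_{n+1})`;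
for `n = 0` there are no trivial components. -/
def b (p : ℕ) (m : ℕ → ℕ) (e : Fin (p ^ m 0 - 1) → ℤ) (n : ℕ) : AutTree (deg p m) n :=
  AutTree.directed
    (fun k x => if h : x.val < p ^ m 0 - 1 then a p m (k + 1) ^ e ⟨x.val, h⟩ else 1) n

/-- The shifted group `G_n = ⟨a_n, b_n⟩ ≤ Aut T_n`; the growing GGS-group with defining vector `e` is
`G = G_0`. -/
def G (p : ℕ) (m : ℕ → ℕ) (e : Fin (p ^ m 0 - 1) → ℤ) (n : ℕ) :
    Subgroup (AutTree (deg p m) n) :=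
  Subgroup.closure {a p m n, b p m e n}

end GrowingGGS

/-! The derived series H_k = G^(k) detects the tree. It is characteristic, H_k fixes level k and is
transitive on each level of every subtree hanging from level k, and H_k contains a non-trivial
element supported below any given vertex of level k (`IsSaturated`).

Such a sequence alone forces the conclusion. Given an automorphism α, let R_v be the part of H_k
supported below the level-k vertex v. Each α(R_v) is normalised by H_k, and these images commute for
distinct v. Two commuting subgroups normalised by H_k cannot both move something below the same w
(`not_moves_of_commute`): after conjugation both move a common vertex w', and commutators then put
into each of them elements that agree below w' with arbitrary elements of R_{w'}, which do not all
commute there. So at most one v belongs to each w. Finiteness of levels gives a bijection of the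
vertices; it preserves prefixes and intertwines g with α(g). Uniqueness holds because a tree
automorphism centralising G preserves the supports of the elements of R_v.

For growing GGS-groups, one derivation costs exactly one level. Sections of G_n^(k+1) lie in
G_{n+1}^(k), since G_n acts on the first level through powers of one cycle; and all of G_{n+1}^(k)
occurs as sections at each letter (`G_le_sectionsOf`, where non-constancy modulo p enters). This
yields fixing and transitivity. The branching hypothesis embeds G_{n+1}^(k+1) in G_n^(k+1) under a
single letter, with no loss of derived length, and this yields the rigid stabilisers. -/

/-! ### Lengths and prefixes of words -/

namespace Vertex

variable {d : ℕ → ℕ}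

/-- The length of a word, that is, the level of the vertex relative to the root of `T_n`. -/
def len : {n : ℕ} → Vertex d n → ℕ
  | _, root => 0
  | _, cons _ u => len u + 1

theorem len_le_len : {n : ℕ} → {u v : Vertex d n} → u ≤ v → len u ≤ len v
  | _, root, _, _ => Nat.zero_le _
  | _, cons _ _, root, h => absurd h cons_le_root
  | _, cons _ _, cons _ _, h => Nat.succ_le_succ (len_le_len (cons_le_cons.1 h).2)

theorem le_of_le_of_le : {n : ℕ} → {u v w : Vertex d n} → u ≤ w → v ≤ w → len u ≤ len v → u ≤ v
  | _, root, _, _, _, _, _ => root_le _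
  | _, cons _ _, root, _, _, _, h => absurd h (Nat.not_succ_le_zero _)
  | _, cons _ _, cons _ _, root, h, _, _ => absurd h cons_le_root
  | _, cons _ _, cons _ _, cons _ _, hu, hv, h =>
      cons_le_cons.2 ⟨(cons_le_cons.1 hu).1.trans (cons_le_cons.1 hv).1.symm,
        le_of_le_of_le (cons_le_cons.1 hu).2 (cons_le_cons.1 hv).2 (Nat.le_of_succ_le_succ h)⟩

theorem eq_of_le_of_le {n : ℕ} {u v w : Vertex d n} (hu : u ≤ w) (hv : v ≤ w)
    (h : len u = len v) : u = v :=
  le_antisymm (le_of_le_of_le hu hv h.le) (le_of_le_of_le hv hu h.ge)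

theorem eq_of_le_of_len_eq {n : ℕ} {u v : Vertex d n} (huv : u ≤ v) (h : len u = len v) : u = v :=
  eq_of_le_of_le huv le_rfl h

theorem len_lt_len {n : ℕ} {u v : Vertex d n} (h : u < v) : len u < len v :=
  lt_of_le_of_ne (len_le_len h.le) fun e => h.ne (eq_of_le_of_len_eq h.le e)

theorem exists_le_len_eq : {n : ℕ} → (v : Vertex d n) → (k : ℕ) → k ≤ len v →
    ∃ u, u ≤ v ∧ len u = k
  | _, _, 0, _ => ⟨root, root_le _, rfl⟩
  | _, root, _ + 1, h => absurd h (Nat.not_succ_le_zero _)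
  | _, cons x v, k + 1, h => by
      obtain ⟨u, hu, rfl⟩ := exists_le_len_eq v k (Nat.le_of_succ_le_succ h)
      exact ⟨cons x u, cons_le_cons.2 ⟨rfl, hu⟩, rfl⟩

theorem exists_len_eq (hd : ∀ n, 0 < d n) : (k : ℕ) → (n : ℕ) → ∃ v : Vertex d n, len v = k
  | 0, _ => ⟨root, rfl⟩
  | k + 1, n => by
      obtain ⟨v, rfl⟩ := exists_len_eq hd k (n + 1)
      exact ⟨cons ⟨0, hd n⟩ v, rfl⟩

theorem exists_ge_len_eq (hd : ∀ n, 0 < d n) : {n : ℕ} → (v : Vertex d n) → (k : ℕ) → len v ≤ k →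
    ∃ w, v ≤ w ∧ len w = k
  | n, root, k, _ => by
      obtain ⟨w, hw⟩ := exists_len_eq hd k n
      exact ⟨w, root_le _, hw⟩
  | _, cons _ _, 0, h => absurd h (Nat.not_succ_le_zero _)
  | _, cons x v, k + 1, h => by
      obtain ⟨w, hw, rfl⟩ := exists_ge_len_eq hd v k (Nat.le_of_succ_le_succ h)
      exact ⟨cons x w, cons_le_cons.2 ⟨rfl, hw⟩, rfl⟩

theorem finite_level : (k n : ℕ) → {v : Vertex d n | len v = k}.Finite
  | 0, n => (Set.finite_singleton (root : Vertex d n)).subset fun v hv => by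
      cases v with
      | root => rfl
      | cons x u => exact absurd hv (Nat.succ_ne_zero _)
  | k + 1, n => by
      refine (Set.finite_iUnion fun x : Fin (d n) =>
        (finite_level k (n + 1)).image (cons x)).subset fun v hv => ?_
      cases v with
      | root => exact absurd hv.symm (Nat.succ_ne_zero _)
      | cons x u => exact Set.mem_iUnion.2 ⟨x, u, Nat.succ.inj hv, rfl⟩

end Vertex

/-! ### Levels and rigid stabilisers -/

namespace AutTree

open Vertex

variable {d : ℕ → ℕ} {n : ℕ}

theorem mul_apply (f g : AutTree d n) (v : Vertex d n) : (f * g) v = f (g v) := rfl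

theorem inv_apply_self (f : AutTree d n) (v : Vertex d n) : f⁻¹ (f v) = v := f.symm_apply_apply v

theorem apply_inv_self (f : AutTree d n) (v : Vertex d n) : f (f⁻¹ v) = v := f.apply_symm_apply v

/-- An order isomorphism carries the strict chain of prefixes of a word to a strict chain, along
which length strictly increases. -/
theorem len_le_len_apply (f : AutTree d n) (k : ℕ) :
    ∀ v : Vertex d n, len v = k → k ≤ len (f v) := by
  induction k with
  | zero => exact fun _ _ => Nat.zero_le _
  | succ k ih =>
    intro v hv
    obtain ⟨u, huv, hu⟩ := exists_le_len_eq v k (by omega)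
    have hlt : u < v := lt_of_le_of_ne huv (by rintro rfl; omega)
    exact (ih u hu).trans_lt (len_lt_len (f.lt_iff_lt.2 hlt))

theorem len_apply (f : AutTree d n) (v : Vertex d n) : len (f v) = len v := by
  refine le_antisymm ?_ (len_le_len_apply f _ v rfl)
  simpa [inv_apply_self] using len_le_len_apply f⁻¹ _ (f v) rfl

theorem apply_eq_of_le {f : AutTree d n} {u v : Vertex d n} (huv : u ≤ v) (hv : f v = v) :
    f u = u :=
  eq_of_le_of_le (by simpa [hv] using f.le_iff_le.2 huv) huv (len_apply f u)

theorem exists_apply_ne {f : AutTree d n} (hf : f ≠ 1) : ∃ v, f v ≠ v := by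
  by_contra! h
  exact hf (RelIso.ext h)

/-- The rigid stabiliser of `v`: the automorphisms supported on the subtree hanging from `v`. -/
def rist (v : Vertex d n) : Subgroup (AutTree d n) where
  carrier := {f | ∀ u, ¬ v ≤ u → f u = u}
  one_mem' := fun _ _ => rfl
  mul_mem' := fun {f g} hf hg u hu => by rw [mul_apply, hg u hu, hf u hu]
  inv_mem' := fun {f} hf u hu => by
    conv_lhs => rw [← hf u hu]
    exact inv_apply_self f u

theorem apply_self_of_mem_rist {f : AutTree d n} {v : Vertex d n} (hf : f ∈ rist v) : f v = v := by
  by_contra h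
  have hlt : ¬ v ≤ f v := fun hle => h (eq_of_le_of_len_eq hle (len_apply f v).symm).symm
  exact h (f.injective (hf (f v) hlt))

theorem rist_anti {v w : Vertex d n} (h : v ≤ w) : rist w ≤ rist v :=
  fun _ hf u hu => hf u fun hw => hu (h.trans hw)

theorem conj_mem_rist {f : AutTree d n} {v : Vertex d n} (g : AutTree d n) (hf : f ∈ rist v) :
    g * f * g⁻¹ ∈ rist (g v) := by
  intro u hu
  have : ¬ v ≤ g⁻¹ u := fun h => hu (by simpa [apply_inv_self] using g.le_iff_le.2 h)
  rw [mul_apply, mul_apply, hf _ this, apply_inv_self]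

theorem le_apply_iff_of_apply_eq {f : AutTree d n} {v u : Vertex d n} (hf : f v = v) :
    v ≤ f u ↔ v ≤ u := by
  conv_lhs => rw [← hf]
  exact f.le_iff_le

theorem commute_of_mem_rist {f g : AutTree d n} {v w : Vertex d n} (hvw : ¬ v ≤ w)
    (hwv : ¬ w ≤ v) (hf : f ∈ rist v) (hg : g ∈ rist w) : f * g = g * f := by
  have hdisj : ∀ u, v ≤ u → ¬ w ≤ u := fun u hv hw =>
    (le_total (len v) (len w)).elim (fun h => hvw (le_of_le_of_le hv hw h))
      fun h => hwv (le_of_le_of_le hw hv h)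
  apply RelIso.ext
  intro u
  rw [mul_apply, mul_apply]
  by_cases hv : v ≤ u
  · rw [hg u (hdisj u hv),
      hg (f u) (hdisj _ ((le_apply_iff_of_apply_eq (apply_self_of_mem_rist hf)).2 hv))]
  · rw [hf u hv]
    by_cases hw : w ≤ u
    · exact hf _ fun h => hdisj _ h
        ((le_apply_iff_of_apply_eq (apply_self_of_mem_rist hg)).2 hw)
    · rw [hg u hw, hf u hv]

/-- `f` supported below `u`, `g` moves `u`: then `g f⁻¹ g⁻¹ f` agrees with `f` below `u`. -/
theorem commutator_apply_of_mem_rist {f g : AutTree d n} {u w : Vertex d n} (hf : f ∈ rist u)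
    (hg : g u ≠ u) (hw : u ≤ w) : (g * f⁻¹ * g⁻¹ * f) w = f w := by
  simp only [mul_apply]
  have hfw : u ≤ f w := (le_apply_iff_of_apply_eq (apply_self_of_mem_rist hf)).2 hw
  -- The point `f w` is below `u`, hence not below `g u`, which is another vertex of the same level;
  -- so `f⁻¹` does not affect `g⁻¹ (f w)`.
  have hn : ¬ u ≤ g⁻¹ (f w) := fun h => by
    have h' : g u ≤ f w := by simpa [apply_inv_self] using g.le_iff_le.2 h
    exact hg (eq_of_le_of_le h' hfw (len_apply g u))
  rw [inv_mem hf _ hn, apply_inv_self]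

/-! ### Saturated sequences and reconstruction of the tree automorphism -/

/-- A decreasing sequence of characteristic subgroups of a group `Γ` of tree automorphisms, whose
`k`-th term fixes level `k` and acts level-transitively on the subtrees hanging from level `k`, with
non-trivial rigid stabilisers. -/
structure IsSaturated (Γ : Subgroup (AutTree d 0)) (H : ℕ → Subgroup Γ) : Prop where
  characteristic : ∀ k, (H k).Characteristic
  antitone : Antitone H
  fix : ∀ k, ∀ g ∈ H k, ∀ v : Vertex d 0, len v ≤ k → g.1 v = v
  transitive : ∀ v w w' : Vertex d 0, v ≤ w → v ≤ w' → len w = len w' →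
    ∃ g ∈ H (len v), g.1 w = w'
  exists_rist : ∀ v : Vertex d 0, ∃ g ∈ H (len v), g ≠ 1 ∧ g.1 ∈ rist v

namespace IsSaturated

variable {Γ : Subgroup (AutTree d 0)} {H : ℕ → Subgroup Γ}

/-- The rigid stabiliser of `v` in the term of `H` that belongs to the level of `v`. -/
def ristIn (H : ℕ → Subgroup Γ) (v : Vertex d 0) : Subgroup Γ :=
  H (len v) ⊓ (rist v).subgroupOf Γ

theorem mem_ristIn {v : Vertex d 0} {g : Γ} : g ∈ ristIn H v ↔ g ∈ H (len v) ∧ g.1 ∈ rist v :=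
  Iff.rfl

theorem ristIn_anti (hH : IsSaturated Γ H) {v w : Vertex d 0} (h : v ≤ w) :
    ristIn H w ≤ ristIn H v :=
  fun _ hg => ⟨hH.antitone (len_le_len h) hg.1, rist_anti h hg.2⟩

theorem conj_mem_ristIn (hH : IsSaturated Γ H) {v : Vertex d 0} {f : Γ} (g : Γ)
    (hf : f ∈ ristIn H v) : g * f * g⁻¹ ∈ ristIn H (g.1 v) := by
  have := hH.characteristic (len v)
  refine ⟨?_, conj_mem_rist g.1 hf.2⟩
  rw [len_apply]
  exact (inferInstance : (H (len v)).Normal).conj_mem f hf.1 g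

theorem exists_ristIn_apply_ne (hH : IsSaturated Γ H) (v : Vertex d 0) :
    ∃ g ∈ ristIn H v, ∃ w, v ≤ w ∧ g.1 w ≠ w := by
  obtain ⟨g, hg, hg1, hgv⟩ := hH.exists_rist v
  obtain ⟨w, hw⟩ := exists_apply_ne fun h : g.1 = 1 => hg1 (Subtype.ext h)
  exact ⟨g, ⟨hg, hgv⟩, w, by_contra fun h => hw (hgv w h), hw⟩

/-- Take `y` supported below a vertex `w` that `x` moves, and `z` below `w` moved by `y`: then `x z`
has left the support of `y`. -/
theorem exists_not_commute (hH : IsSaturated Γ H) (u : Vertex d 0) :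
    ∃ x ∈ ristIn H u, ∃ y ∈ ristIn H u, ∃ z, u ≤ z ∧ x.1 (y.1 z) ≠ y.1 (x.1 z) := by
  obtain ⟨x, hx, w, huw, hxw⟩ := hH.exists_ristIn_apply_ne u
  obtain ⟨y, hy, z, hwz, hyz⟩ := hH.exists_ristIn_apply_ne w
  refine ⟨x, hx, y, hH.ristIn_anti huw hy, z, huw.trans hwz, fun h => hyz ?_⟩
  have hn : ¬ w ≤ x.1 z := fun hle =>
    hxw (eq_of_le_of_le (x.1.le_iff_le.2 hwz) hle (len_apply x.1 w))
  rw [(mem_ristIn.1 hy).2 _ hn] at h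
  exact x.1.injective h

/-- Some element of `N` moves a vertex below `v`. -/
def Moves (N : Subgroup Γ) (v : Vertex d 0) : Prop :=
  ∃ g ∈ N, ∃ u, v ≤ u ∧ g.1 u ≠ u

/-- Commuting normal subgroups of `H k` have disjoint supports on level `k`. -/
theorem not_moves_of_commute (hH : IsSaturated Γ H) (hd : ∀ n, 0 < d n) {v : Vertex d 0}
    {N₁ N₂ : Subgroup Γ}
    (hn₁ : ∀ h ∈ H (len v), ∀ g ∈ N₁, h * g * h⁻¹ ∈ N₁)
    (hn₂ : ∀ h ∈ H (len v), ∀ g ∈ N₂, h * g * h⁻¹ ∈ N₂)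
    (hc : ∀ g ∈ N₁, ∀ h ∈ N₂, g * h = h * g) (h₁ : Moves N₁ v) (h₂ : Moves N₂ v) : False := by
  obtain ⟨g₁, hg₁, u₁, hu₁, hm₁⟩ := h₁
  obtain ⟨g₂, hg₂, u₂, hu₂, hm₂⟩ := h₂
  -- Extend both moved vertices to a common level, where transitivity can bring them together.
  obtain ⟨w₁, hw₁, hl₁⟩ := exists_ge_len_eq hd u₁ (max (len u₁) (len u₂)) (le_max_left _ _)
  obtain ⟨w, hw, hl⟩ := exists_ge_len_eq hd u₂ (max (len u₁) (len u₂)) (le_max_right _ _)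
  replace hm₁ : g₁.1 w₁ ≠ w₁ := fun h => hm₁ (apply_eq_of_le hw₁ h)
  replace hm₂ : g₂.1 w ≠ w := fun h => hm₂ (apply_eq_of_le hw h)
  have hvw : v ≤ w := hu₂.trans hw
  obtain ⟨h, hh, hhw⟩ := hH.transitive v w₁ w (hu₁.trans hw₁) hvw (hl₁.trans hl.symm)
  have hm : (h * g₁ * h⁻¹).1 w ≠ w := by
    intro hfix
    apply hm₁
    rw [← hhw] at hfix
    change h.1 (g₁.1 (h.1⁻¹ (h.1 w₁))) = h.1 w₁ at hfix
    rw [inv_apply_self] at hfix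
    exact h.1.injective hfix
  -- The commutator `g * x⁻¹ * g⁻¹ * x` lies in `N` by normalisation, and acts as `x` below `w`
  -- because `g` moves `w`.
  have key : ∀ N : Subgroup Γ, (∀ h ∈ H (len v), ∀ g ∈ N, h * g * h⁻¹ ∈ N) → ∀ g ∈ N, g.1 w ≠ w →
      ∀ x ∈ ristIn H w, ∃ c ∈ N, ∀ z, w ≤ z → c.1 z = x.1 z := by
    intro N hN g hg hgw x hx
    have hxv : x⁻¹ ∈ H (len v) := inv_mem (hH.ristIn_anti hvw hx).1
    have hc : g * x⁻¹ * g⁻¹ * x = g * (x⁻¹ * g⁻¹ * x⁻¹⁻¹) := by group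
    refine ⟨g * x⁻¹ * g⁻¹ * x, ?_, fun z hz => commutator_apply_of_mem_rist hx.2 hgw hz⟩
    rw [hc]
    exact mul_mem hg (hN _ hxv _ (inv_mem hg))
  obtain ⟨x, hx, y, hy, z, hz, hne⟩ := hH.exists_not_commute w
  obtain ⟨c₁, hc₁, hcx⟩ := key N₁ hn₁ _ (hn₁ h hh g₁ hg₁) hm x hx
  obtain ⟨c₂, hc₂, hcy⟩ := key N₂ hn₂ _ hg₂ hm₂ y hy
  have hle : ∀ f ∈ ristIn H w, w ≤ f.1 z := fun f hf =>
    (le_apply_iff_of_apply_eq (apply_self_of_mem_rist hf.2)).2 hz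
  have hcomm := congrArg (fun f : Γ => f.1 z) (hc c₁ hc₁ c₂ hc₂)
  change c₁.1 (c₂.1 z) = c₂.1 (c₁.1 z) at hcomm
  rw [hcy z hz, hcx z hz, hcx _ (hle y hy), hcy _ (hle x hx)] at hcomm
  exact hne hcomm

variable (α : MulAut Γ)

/-- The image under `α` of the rigid stabiliser of `v` moves a vertex below `w`, with `v` and `w` on
the same level. -/
def Rel (H : ℕ → Subgroup Γ) (α : MulAut Γ) (v w : Vertex d 0) : Prop :=
  len v = len w ∧ Moves ((ristIn H v).map α.toMonoidHom) w

variable {α}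

theorem map_characteristic (hH : IsSaturated Γ H) (k : ℕ) {g : Γ} (hg : g ∈ H k) : α g ∈ H k := by
  have h := Subgroup.characteristic_iff_map_eq.1 (hH.characteristic k) α
  rw [← h]
  exact ⟨g, hg, rfl⟩

/-- Distinct vertices of one level have rigid stabilisers with disjoint supports, so the images
commute and `not_moves_of_commute` applies. -/
theorem Rel.left_unique (hH : IsSaturated Γ H) (hd : ∀ n, 0 < d n) {v v' w : Vertex d 0}
    (h : Rel H α v w) (h' : Rel H α v' w) : v = v' := by
  by_contra hne
  have hl : len v = len v' := h.1.trans h'.1.symm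
  have hn : ∀ v, len v = len w → ∀ k ∈ H (len w), ∀ g ∈ (ristIn H v).map α.toMonoidHom,
      k * g * k⁻¹ ∈ (ristIn H v).map α.toMonoidHom := by
    rintro v hv k hk _ ⟨g, hg, rfl⟩
    -- Pulled back by α, conjugation by `k` becomes conjugation by an element that fixes `v`, hence
    -- preserves its rigid stabiliser.
    have hk' : α⁻¹ k ∈ H (len w) := hH.map_characteristic _ hk
    refine ⟨α⁻¹ k * g * (α⁻¹ k)⁻¹, ?_, by simp⟩
    have := hH.conj_mem_ristIn (α⁻¹ k) hg
    rwa [hH.fix _ _ hk' v hv.le] at this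
  refine hH.not_moves_of_commute hd (hn v h.1) (hn v' h'.1) ?_ h.2 h'.2
  rintro _ ⟨f, hf, rfl⟩ _ ⟨g, hg, rfl⟩
  have : f * g = g * f := Subtype.ext (commute_of_mem_rist
    (fun hle => hne (eq_of_le_of_len_eq hle hl))
    (fun hle => hne (eq_of_le_of_len_eq hle hl.symm).symm) hf.2 hg.2)
  change α f * α g = α g * α f
  rw [← map_mul, this, map_mul]

/-- The image of a non-trivial element is non-trivial and still fixes level `len v`, so whatever it
moves lies deeper and has a prefix on that level. -/
theorem Rel.exists_right (hH : IsSaturated Γ H) (v : Vertex d 0) : ∃ w, Rel H α v w := by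
  obtain ⟨g, hg, hg1, hgv⟩ := hH.exists_rist v
  obtain ⟨u, hu⟩ := exists_apply_ne fun h : (α g).1 = 1 =>
    hg1 ((map_eq_one_iff α α.injective).1 (Subtype.ext h))
  have hlen : len v ≤ len u := by
    by_contra! h
    exact hu (hH.fix _ _ (hH.map_characteristic _ hg) u h.le)
  obtain ⟨w, hwu, hw⟩ := exists_le_len_eq u (len v) hlen
  exact ⟨w, hw.symm, α g, ⟨g, ⟨hg, hgv⟩, rfl⟩, u, hwu, hu⟩

/-- The map on vertices induced by an automorphism of `Γ`. -/
noncomputable def vertexMap (hH : IsSaturated Γ H) (α : MulAut Γ) (v : Vertex d 0) : Vertex d 0 :=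
  (Rel.exists_right (α := α) hH v).choose

theorem rel_vertexMap (hH : IsSaturated Γ H) (v : Vertex d 0) : Rel H α v (hH.vertexMap α v) :=
  (Rel.exists_right hH v).choose_spec

theorem len_vertexMap (hH : IsSaturated Γ H) (v : Vertex d 0) :
    len (hH.vertexMap α v) = len v :=
  (hH.rel_vertexMap v).1.symm

theorem vertexMap_injective (hH : IsSaturated Γ H) (hd : ∀ n, 0 < d n) :
    Function.Injective (hH.vertexMap α) := fun v v' h =>
  Rel.left_unique hH hd (hH.rel_vertexMap v) (h ▸ hH.rel_vertexMap v')

theorem vertexMap_surjective (hH : IsSaturated Γ H) (hd : ∀ n, 0 < d n) :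
    Function.Surjective (hH.vertexMap α) := by
  intro w
  have hmaps : Set.MapsTo (hH.vertexMap α) {v | len v = len w} {v | len v = len w} :=
    fun v hv => (hH.len_vertexMap v).trans hv
  obtain ⟨v, -, hv⟩ := (((finite_level (len w) 0).injOn_iff_bijOn_of_mapsTo hmaps).1
    (hH.vertexMap_injective hd).injOn).surjOn (rfl : len w = len w)
  exact ⟨v, hv⟩

/-- Surjectivity turns uniqueness on the left into uniqueness on the right, so the choice in
`vertexMap` is immaterial. -/
theorem Rel.eq_vertexMap (hH : IsSaturated Γ H) (hd : ∀ n, 0 < d n) {v w : Vertex d 0}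
    (h : Rel H α v w) : w = hH.vertexMap α v := by
  obtain ⟨v', rfl⟩ := hH.vertexMap_surjective (α := α) hd w
  rw [Rel.left_unique hH hd h (hH.rel_vertexMap v')]

/-- Rigid stabilisers shrink down the tree, so a vertex moved by the image for `v'` is moved by the
image for `v`. Both values are then prefixes of that one vertex. -/
theorem vertexMap_mono (hH : IsSaturated Γ H) (hd : ∀ n, 0 < d n) {v v' : Vertex d 0}
    (h : v ≤ v') : hH.vertexMap α v ≤ hH.vertexMap α v' := by
  obtain ⟨hl, g, hg, u, hu, hgu⟩ := hH.rel_vertexMap (α := α) v'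
  have hvu : len v ≤ len u := (len_le_len h).trans (hl.le.trans (len_le_len hu))
  obtain ⟨w, hwu, hw⟩ := exists_le_len_eq u (len v) hvu
  have hrel : Rel H α v w :=
    ⟨hw.symm, g, Subgroup.map_mono (hH.ristIn_anti h) hg, u, hwu, hgu⟩
  rw [← hrel.eq_vertexMap hH hd]
  exact le_of_le_of_le hwu hu (by rw [hw, ← hl]; exact len_le_len h)

theorem vertexMap_le_iff (hH : IsSaturated Γ H) (hd : ∀ n, 0 < d n) {v v' : Vertex d 0} :
    hH.vertexMap α v ≤ hH.vertexMap α v' ↔ v ≤ v' := by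
  refine ⟨fun h => ?_, hH.vertexMap_mono hd⟩
  have hl : len v ≤ len v' := by simpa [len_vertexMap] using len_le_len h
  obtain ⟨u, huv, hu⟩ := exists_le_len_eq v' (len v) hl
  have : hH.vertexMap α u = hH.vertexMap α v :=
    eq_of_le_of_le (hH.vertexMap_mono hd huv) h (by simp [len_vertexMap, hu])
  rwa [← hH.vertexMap_injective hd this]

/-- The tree automorphism induced by an automorphism of `Γ`. -/
noncomputable def treeAut (hH : IsSaturated Γ H) (hd : ∀ n, 0 < d n) (α : MulAut Γ) :
    AutTree d 0 where
  toEquiv := Equiv.ofBijective (hH.vertexMap α)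
    ⟨hH.vertexMap_injective hd, hH.vertexMap_surjective hd⟩
  map_rel_iff' := hH.vertexMap_le_iff hd

theorem treeAut_mul (hH : IsSaturated Γ H) (hd : ∀ n, 0 < d n) (g : Γ) :
    hH.treeAut hd α * g.1 = (α g).1 * hH.treeAut hd α := by
  apply RelIso.ext
  intro v
  change hH.vertexMap α (g.1 v) = (α g).1 (hH.vertexMap α v)
  symm
  apply Rel.eq_vertexMap hH hd
  obtain ⟨hl, _, ⟨f, hf, rfl⟩, u, hu, hfu⟩ := hH.rel_vertexMap (α := α) v
  refine ⟨by rw [len_apply, len_apply, hl], α (g * f * g⁻¹),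
    ⟨_, hH.conj_mem_ristIn g hf, rfl⟩, (α g).1 u, (α g).1.le_iff_le.2 hu, fun h => hfu ?_⟩
  rw [map_mul, map_mul, map_inv] at h
  change (α g).1 ((α f).1 ((α g).1⁻¹ ((α g).1 u))) = (α g).1 u at h
  rw [inv_apply_self] at h
  exact (α g).1.injective h

theorem treeAut_conj (hH : IsSaturated Γ H) (hd : ∀ n, 0 < d n) (g : Γ) :
    hH.treeAut hd α * g.1 * (hH.treeAut hd α)⁻¹ = (α g).1 := by
  rw [treeAut_mul, mul_inv_cancel_right]

theorem treeAut_mem_normalizer (hH : IsSaturated Γ H) (hd : ∀ n, 0 < d n) :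
    hH.treeAut hd α ∈ Subgroup.normalizer (Γ : Set (AutTree d 0)) := by
  rw [Subgroup.mem_normalizer_iff]
  intro h
  refine ⟨fun hh => ?_, fun hh => ?_⟩
  · rw [hH.treeAut_conj hd ⟨h, hh⟩]
    exact (α ⟨h, hh⟩).2
  · have := hH.treeAut_conj (α := α) hd (α⁻¹ ⟨_, hh⟩)
    simp only [MulAut.apply_inv_self] at this
    rw [mul_left_inj, mul_right_inj] at this
    rw [← this]
    exact (α⁻¹ ⟨_, hh⟩).2

/-- An automorphism of the tree that centralises `Γ` is trivial. -/
theorem eq_one_of_commute (hH : IsSaturated Γ H) {f : AutTree d 0}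
    (hf : ∀ g : Γ, f * g.1 * f⁻¹ = g.1) : f = 1 := by
  apply RelIso.ext
  intro v
  obtain ⟨g, hg, w, hvw, hgw⟩ := hH.exists_ristIn_apply_ne v
  -- Since `f` commutes with `g`, the support of `g` is also below `f v`; a moved `w` thus has both
  -- `v` and `f v` as prefixes.
  have hmem := conj_mem_rist f (mem_ristIn.1 hg).2
  rw [hf g] at hmem
  exact eq_of_le_of_le (by_contra fun h => hgw (hmem w h)) hvw (len_apply f v)

/-- Every automorphism of a group of tree automorphisms with a saturated sequence is induced by a
unique element of its normaliser. -/
theorem bijective_normalizerMonoidHom (hH : IsSaturated Γ H) (hd : ∀ n, 0 < d n) :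
    Function.Bijective Γ.normalizerMonoidHom := by
  constructor
  · rw [injective_iff_map_eq_one]
    intro f hf
    apply Subtype.ext
    refine hH.eq_one_of_commute fun g => ?_
    exact congrArg Subtype.val (DFunLike.congr_fun hf g)
  · intro α
    refine ⟨⟨hH.treeAut hd α, hH.treeAut_mem_normalizer hd⟩, ?_⟩
    ext1 g
    exact Subtype.ext (hH.treeAut_conj hd g)

end IsSaturated

end AutTree

/-! ### Derived subgroups and the cycle -/

open scoped commutatorElement

/-- The iterated derived subgroups of a subgroup, as subgroups of the ambient group. -/
def iterDerived {Γ : Type*} [Group Γ] (K : Subgroup Γ) : ℕ → Subgroup Γ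
  | 0 => K
  | k + 1 => ⁅iterDerived K k, iterDerived K k⁆

theorem map_subtype_derivedSeries {Γ : Type*} [Group Γ] (K : Subgroup Γ) (k : ℕ) :
    (derivedSeries K k).map K.subtype = iterDerived K k := by
  induction k with
  | zero => simp [iterDerived, ← MonoidHom.range_eq_map]
  | succ k ih => rw [derivedSeries_succ, Subgroup.map_commutator, ih, iterDerived]

theorem iterDerived_succ_le {Γ : Type*} [Group Γ] (K : Subgroup Γ) (k : ℕ) :
    iterDerived K (k + 1) ≤ iterDerived K k :=
  Subgroup.commutator_le_self _

theorem finRotate_pow_self (N : ℕ) (hN : 2 ≤ N) : finRotate N ^ N = 1 := by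
  obtain ⟨N, rfl⟩ := Nat.exists_eq_add_of_le' hN
  have h := isCycle_finRotate (n := N).orderOf
  rw [support_finRotate, Finset.card_univ, Fintype.card_fin] at h
  simpa only [h] using pow_orderOf_eq_one (finRotate (N + 2))

theorem exists_finRotate_zpow_apply (N : ℕ) (hN : 2 ≤ N) (x y : Fin N) :
    ∃ i : ℤ, (finRotate N ^ i) x = y := by
  obtain ⟨N, rfl⟩ := Nat.exists_eq_add_of_le' hN
  have hmem : ∀ z : Fin (N + 2), finRotate (N + 2) z ≠ z := fun z => by
    rw [← Equiv.Perm.mem_support, support_finRotate]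
    exact Finset.mem_univ z
  exact isCycle_finRotate.sameCycle (hmem x) (hmem y)

/-! ### Sections and insertion under a letter -/

namespace AutTree

open Vertex

variable {d : ℕ → ℕ} {n : ℕ}

/-- `g` acts on the first level as `σ`, with all first-level sections in `K`. -/
def HasSections (K : Subgroup (AutTree d (n + 1))) (g : AutTree d n)
    (σ : Equiv.Perm (Fin (d n))) : Prop :=
  ∀ x, ∃ s ∈ K, ∀ u, g (cons x u) = cons (σ x) (s u)

namespace HasSections

variable {K : Subgroup (AutTree d (n + 1))}

theorem one : HasSections K 1 1 := fun _ => ⟨1, one_mem _, fun _ => rfl⟩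

theorem mul {g h : AutTree d n} {σ τ : Equiv.Perm (Fin (d n))} (hg : HasSections K g σ)
    (hh : HasSections K h τ) : HasSections K (g * h) (σ * τ) := by
  intro x
  obtain ⟨t, ht, hht⟩ := hh x
  obtain ⟨s, hs, hgs⟩ := hg (τ x)
  exact ⟨s * t, mul_mem hs ht, fun u => by rw [mul_apply, hht, hgs]; rfl⟩

theorem inv {g : AutTree d n} {σ : Equiv.Perm (Fin (d n))} (hg : HasSections K g σ) :
    HasSections K g⁻¹ σ⁻¹ := by
  intro x
  obtain ⟨s, hs, hgs⟩ := hg (σ⁻¹ x)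
  refine ⟨s⁻¹, inv_mem hs, fun u => ?_⟩
  have := hgs (s⁻¹ u)
  rw [apply_inv_self, show σ (σ⁻¹ x) = x from σ.apply_symm_apply x] at this
  rw [← this, inv_apply_self]

end HasSections

/-- `g` fixes the first-level vertex `x` and `s` is its section there. -/
def IsSection (g : AutTree d n) (x : Fin (d n)) (s : AutTree d (n + 1)) : Prop :=
  ∀ u, g (cons x u) = cons x (s u)

namespace IsSection

variable {g h : AutTree d n} {x : Fin (d n)} {s t : AutTree d (n + 1)}

theorem mul (hg : IsSection g x s) (hh : IsSection h x t) : IsSection (g * h) x (s * t) :=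
  fun u => by rw [mul_apply, hh, hg, mul_apply]

theorem inv (hg : IsSection g x s) : IsSection g⁻¹ x s⁻¹ := fun u => by
  have := hg (s⁻¹ u)
  rw [apply_inv_self] at this
  rw [← this, inv_apply_self]

theorem commutator (hg : IsSection g x s) (hh : IsSection h x t) : IsSection ⁅g, h⁆ x ⁅s, t⁆ :=
  ((hg.mul hh).mul hg.inv).mul hh.inv

end IsSection

/-- The elements of the first level stabiliser with all sections in `K`. -/
def withSections (K : Subgroup (AutTree d (n + 1))) : Subgroup (AutTree d n) where
  carrier := {g | HasSections K g 1}
  one_mem' := HasSections.one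
  mul_mem' := fun hg hh => by simpa using HasSections.mul hg hh
  inv_mem' := fun hg => by simpa using HasSections.inv hg

/-- The sections at `x` of the elements of `K` that fix `x`. -/
def sectionsOf (K : Subgroup (AutTree d n)) (x : Fin (d n)) : Subgroup (AutTree d (n + 1)) where
  carrier := {s | ∃ g ∈ K, IsSection g x s}
  one_mem' := ⟨1, one_mem _, fun _ => rfl⟩
  mul_mem' := by
    rintro _ _ ⟨g, hg, hgs⟩ ⟨h, hh, hht⟩
    exact ⟨g * h, mul_mem hg hh, hgs.mul hht⟩
  inv_mem' := by
    rintro _ ⟨g, hg, hgs⟩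
    exact ⟨g⁻¹, inv_mem hg, hgs.inv⟩

theorem commutator_le_withSections {K : Subgroup (AutTree d n)} {L : Subgroup (AutTree d (n + 1))}
    (h : K ≤ withSections L) : ⁅K, K⁆ ≤ withSections ⁅L, L⁆ := by
  refine Subgroup.commutator_le.2 fun f hf g hg x => ?_
  obtain ⟨s, hs, hfs⟩ := h hf x
  obtain ⟨t, ht, hgt⟩ := h hg x
  exact ⟨⁅s, t⁆, Subgroup.commutator_mem_commutator hs ht, IsSection.commutator hfs hgt⟩

theorem commutator_le_sectionsOf {K : Subgroup (AutTree d n)} {L : Subgroup (AutTree d (n + 1))}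
    {x : Fin (d n)} (h : L ≤ sectionsOf K x) : ⁅L, L⁆ ≤ sectionsOf ⁅K, K⁆ x := by
  refine Subgroup.commutator_le.2 fun s hs t ht => ?_
  obtain ⟨f, hf, hfs⟩ := h hs
  obtain ⟨g, hg, hgt⟩ := h ht
  exact ⟨⁅f, g⁆, Subgroup.commutator_mem_commutator hf hg, hfs.commutator hgt⟩

/-- The embedding of `Aut T_{n+1}` into `Aut T_n` as the rigid stabiliser of the first-level
vertex `x`. -/
noncomputable def insertAt (x : Fin (d n)) : AutTree d (n + 1) →* AutTree d n :=
  (levelStab d n).subtype.comp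
    ((psi d n).symm.toMonoidHom.comp (MonoidHom.mulSingle (fun _ => AutTree d (n + 1)) x))

theorem insertAt_cons (x y : Fin (d n)) (g : AutTree d (n + 1)) (u : Vertex d (n + 1)) :
    insertAt x g (cons y u) =
      cons y ((Pi.mulSingle x g : Fin (d n) → AutTree d (n + 1)) y u) := rfl

theorem insertAt_mem_rist {x : Fin (d n)} {g : AutTree d (n + 1)} {v : Vertex d (n + 1)}
    (hg : g ∈ rist v) : insertAt x g ∈ rist (cons x v) := by
  rintro (_ | ⟨y, u⟩) hu
  · exact map_root _
  · rw [insertAt_cons]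
    by_cases hxy : y = x
    · subst hxy
      rw [Pi.mulSingle_eq_same, hg u fun h => hu (cons_le_cons.2 ⟨rfl, h⟩)]
    · rw [Pi.mulSingle_eq_of_ne hxy]
      rfl

theorem insertAt_injective (x : Fin (d n)) :
    Function.Injective (insertAt x : AutTree d (n + 1) →* AutTree d n) :=
  Subtype.val_injective.comp ((psi d n).symm.injective.comp fun _ _ h => Pi.mulSingle_injective x h)

end AutTree

/-! ### Sections of growing GGS-groups -/

namespace GrowingGGS

open Vertex AutTree

variable {p : ℕ} {m : ℕ → ℕ} {e : Fin (p ^ m 0 - 1) → ℤ}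

/-- The section of `b_n` at the first-level vertex `x`. -/
def bSection (p : ℕ) (m : ℕ → ℕ) (e : Fin (p ^ m 0 - 1) → ℤ) (n : ℕ) (x : Fin (deg p m n)) :
    AutTree (deg p m) (n + 1) :=
  if x.val + 1 = deg p m n then b p m e (n + 1)
  else if h : x.val < p ^ m 0 - 1 then a p m (n + 1) ^ e ⟨x.val, h⟩ else 1

theorem isSection_b (n : ℕ) (x : Fin (deg p m n)) :
    IsSection (b p m e n) x (bSection p m e n x) := by
  intro u
  change directedFun (fun k x => if h : x.val < p ^ m 0 - 1 then a p m (k + 1) ^ e ⟨x.val, h⟩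
    else 1) (cons x u) = _
  by_cases hx : x.val + 1 = deg p m n
  · simp only [directedFun, hx, if_true, bSection]
    rfl
  · simp only [directedFun, hx, if_false, bSection]

theorem a_cons (n : ℕ) (x : Fin (deg p m n)) (u : Vertex (deg p m) (n + 1)) :
    a p m n (cons x u) = cons (finRotate _ x) u := rfl

theorem a_pow_cons (n k : ℕ) (x : Fin (deg p m n)) (u : Vertex (deg p m) (n + 1)) :
    (a p m n ^ k) (cons x u) = cons ((finRotate _ ^ k) x) u := by
  induction k generalizing x with
  | zero => rfl
  | succ k ih => rw [pow_succ, pow_succ, AutTree.mul_apply, a_cons, ih, Equiv.Perm.mul_apply]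

theorem a_zpow_cons (n : ℕ) (k : ℤ) (x : Fin (deg p m n)) (u : Vertex (deg p m) (n + 1)) :
    (a p m n ^ k) (cons x u) = cons ((finRotate _ ^ k) x) u := by
  obtain ⟨k, rfl | rfl⟩ := k.eq_nat_or_neg
  · rw [zpow_natCast, zpow_natCast, a_pow_cons]
  · rw [zpow_neg, zpow_neg, zpow_natCast, zpow_natCast]
    conv_lhs => rw [← Equiv.apply_symm_apply (finRotate _ ^ k) x, ← a_pow_cons]
    exact inv_apply_self _ _

theorem two_le_deg (hp : p.Prime) (hm0 : 0 < m 0) (hm : StrictMono m) (n : ℕ) :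
    2 ≤ deg p m n :=
  hp.two_le.trans (Nat.le_self_pow (hm0.trans_le (hm.monotone (Nat.zero_le n))).ne' p)

theorem a_pow_deg (n : ℕ) (h : 2 ≤ deg p m n) : a p m n ^ deg p m n = 1 := by
  apply RelIso.ext
  rintro (_ | ⟨x, u⟩)
  · exact map_root _
  · rw [a_pow_cons, finRotate_pow_self _ h]
    rfl

theorem a_mem (n : ℕ) : a p m n ∈ G p m e n := Subgroup.subset_closure (by simp)

theorem b_mem (n : ℕ) : b p m e n ∈ G p m e n := Subgroup.subset_closure (by simp)

theorem bSection_mem (n : ℕ) (x : Fin (deg p m n)) : bSection p m e n x ∈ G p m e (n + 1) := by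
  unfold bSection
  split_ifs
  · exact b_mem _
  · exact zpow_mem (a_mem _) _
  · exact one_mem _

theorem exists_hasSections (n : ℕ) {g : AutTree (deg p m) n} (hg : g ∈ G p m e n) :
    ∃ σ ∈ Subgroup.zpowers (finRotate (deg p m n)), HasSections (G p m e (n + 1)) g σ := by
  induction hg using Subgroup.closure_induction with
  | mem g hg =>
    rcases hg with rfl | rfl
    · exact ⟨_, Subgroup.mem_zpowers _, fun x => ⟨1, one_mem _, fun u => a_cons n x u⟩⟩
    · exact ⟨1, one_mem _, fun x => ⟨_, bSection_mem n x, isSection_b n x⟩⟩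
  | one => exact ⟨1, one_mem _, HasSections.one⟩
  | mul g h _ _ ihg ihh =>
    obtain ⟨σ, hσ, hg⟩ := ihg
    obtain ⟨τ, hτ, hh⟩ := ihh
    exact ⟨σ * τ, mul_mem hσ hτ, hg.mul hh⟩
  | inv g _ ih =>
    obtain ⟨σ, hσ, hg⟩ := ih
    exact ⟨σ⁻¹, inv_mem hσ, hg.inv⟩

/-- First-level actions are powers of one cycle, so they cancel in commutators. -/
theorem commutator_le_withSections_G (n : ℕ) :
    ⁅G p m e n, G p m e n⁆ ≤ withSections (G p m e (n + 1)) := by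
  refine Subgroup.commutator_le.2 fun g hg h hh => ?_
  obtain ⟨σ, ⟨i, rfl⟩, hσ⟩ := exists_hasSections n hg
  obtain ⟨τ, ⟨j, rfl⟩, hτ⟩ := exists_hasSections n hh
  have := ((hσ.mul hτ).mul hσ.inv).mul hτ.inv
  have hone : finRotate (deg p m n) ^ i * finRotate (deg p m n) ^ j *
      (finRotate (deg p m n) ^ i)⁻¹ * (finRotate (deg p m n) ^ j)⁻¹ = 1 := by
    group
  dsimp only at this
  rwa [hone] at this

/-- Conjugating `b` by powers of `a` brings its section at any letter to `x`. A quotient of two such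
conjugates is a commutator with a power of `a`. -/
theorem bSection_mul_inv_mem (n : ℕ) (hd : 2 ≤ deg p m n) (x y z : Fin (deg p m n)) :
    bSection p m e n y * (bSection p m e n z)⁻¹ ∈ sectionsOf ⁅G p m e n, G p m e n⁆ x := by
  obtain ⟨i, hi⟩ := exists_finRotate_zpow_apply _ hd y z
  obtain ⟨j, hj⟩ := exists_finRotate_zpow_apply _ hd x y
  refine ⟨⁅a p m n ^ (-j) * b p m e n * a p m n ^ j, a p m n ^ (-i)⁆,
    Subgroup.commutator_mem_commutator
      (mul_mem (mul_mem (zpow_mem (a_mem n) _) (b_mem n)) (zpow_mem (a_mem n) _))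
      (zpow_mem (a_mem n) _), fun u => ?_⟩
  have hij : (finRotate (deg p m n) ^ j) ((finRotate _ ^ i) x) = z := by
    rw [← Equiv.Perm.mul_apply, ← zpow_add, add_comm, zpow_add, Equiv.Perm.mul_apply, hj, hi]
  have hz : (finRotate (deg p m n) ^ (-i)) ((finRotate _ ^ (-j)) z) = x := by
    simp only [← hij, zpow_neg, Equiv.Perm.inv_def, Equiv.symm_apply_apply]
  have hy : (finRotate (deg p m n) ^ (-j)) y = x := by
    rw [← hj, zpow_neg, Equiv.Perm.inv_def, Equiv.symm_apply_apply]
  have heq : ⁅a p m n ^ (-j) * b p m e n * a p m n ^ j, a p m n ^ (-i)⁆ =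
      a p m n ^ (-j) * b p m e n * a p m n ^ j * a p m n ^ (-i) *
        a p m n ^ (-j) * (b p m e n)⁻¹ * a p m n ^ j * a p m n ^ i := by
    rw [commutatorElement_def]
    group
  rw [heq]
  simp only [AutTree.mul_apply, a_zpow_cons, hij, (isSection_b n z).inv _, hz, hj,
    isSection_b n y _, hy]

/-- Two entries of `e` that differ modulo p give a power of `a` with exponent prime to p, which
generates `a` because the order of `a` divides a power of p. The last letter then gives `b` up to a
power of `a`. -/
theorem G_le_sectionsOf (hp : p.Prime) (hm0 : 0 < m 0) (hm : StrictMono m)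
    (henc : ∃ i j, ¬ e i ≡ e j [ZMOD p]) (n : ℕ) (x : Fin (deg p m n)) :
    G p m e (n + 1) ≤ sectionsOf ⁅G p m e n, G p m e n⁆ x := by
  obtain ⟨i, j, hij⟩ := henc
  have hd := two_le_deg hp hm0 hm
  have hle : p ^ m 0 ≤ deg p m n := Nat.pow_le_pow_right hp.pos (hm.monotone (Nat.zero_le n))
  have hlt : ∀ i : Fin (p ^ m 0 - 1), i.val + 1 < deg p m n := fun i => by
    have := i.2
    omega
  have hsec : ∀ i : Fin (p ^ m 0 - 1),
      bSection p m e n ⟨i.val, (Nat.lt_succ_self _).trans (hlt i)⟩ = a p m (n + 1) ^ e i := by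
    intro i
    have hi : i.val < p ^ m 0 - 1 := i.2
    simp only [bSection, (hlt i).ne, if_false, hi, dif_pos]
  have hlast : bSection p m e n ⟨deg p m n - 1, by have := hd n; omega⟩ = b p m e (n + 1) := by
    have : deg p m n - 1 + 1 = deg p m n := by have := hd n; omega
    simp only [bSection, this, if_true]
  have hmem := bSection_mul_inv_mem (e := e) n (hd n) x
  have ha : a p m (n + 1) ∈ sectionsOf ⁅G p m e n, G p m e n⁆ x := by
    have h := hmem ⟨j.val, (Nat.lt_succ_self _).trans (hlt j)⟩
      ⟨i.val, (Nat.lt_succ_self _).trans (hlt i)⟩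
    rw [hsec, hsec, ← zpow_neg, ← zpow_add, ← sub_eq_add_neg] at h
    have hcop : IsCoprime (e j - e i) ((deg p m (n + 1) : ℕ) : ℤ) := by
      rw [Nat.cast_pow]
      refine IsCoprime.pow_right (IsCoprime.symm ?_)
      rw [Prime.coprime_iff_not_dvd (Nat.prime_iff_prime_int.1 hp)]
      exact fun hdvd => hij (Int.modEq_iff_dvd.2 hdvd)
    obtain ⟨r, s, hrs⟩ := hcop
    have hone : a p m (n + 1) = (a p m (n + 1) ^ (e j - e i)) ^ r := by
      conv_lhs => rw [← zpow_one (a p m (n + 1)), ← hrs]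
      rw [zpow_add, mul_comm s, zpow_mul _ _ s, zpow_natCast, a_pow_deg _ (hd _), one_zpow,
        mul_one, mul_comm r, zpow_mul]
    rw [hone]
    exact zpow_mem h r
  have hb : b p m e (n + 1) ∈ sectionsOf ⁅G p m e n, G p m e n⁆ x := by
    have h := hmem ⟨deg p m n - 1, by have := hd n; omega⟩
      ⟨i.val, (Nat.lt_succ_self _).trans (hlt i)⟩
    rw [hlast, hsec] at h
    simpa using mul_mem h (zpow_mem ha (e i))
  rw [G, Subgroup.closure_le]
  rintro _ (rfl | rfl)
  exacts [ha, hb]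

/-! ### Saturation of the derived series -/

/-- The `k`-th derived subgroup of `G_n`. -/
abbrev derived (p : ℕ) (m : ℕ → ℕ) (e : Fin (p ^ m 0 - 1) → ℤ) (n k : ℕ) :
    Subgroup (AutTree (deg p m) n) :=
  iterDerived (G p m e n) k

theorem derived_le_withSections (n k : ℕ) :
    derived p m e n (k + 1) ≤ withSections (derived p m e (n + 1) k) := by
  induction k with
  | zero => exact commutator_le_withSections_G n
  | succ k ih => exact commutator_le_withSections ih

theorem derived_le_sectionsOf (hG : ∀ n x, G p m e (n + 1) ≤ sectionsOf ⁅G p m e n, G p m e n⁆ x)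
    (n k : ℕ) (x : Fin (deg p m n)) :
    derived p m e (n + 1) k ≤ sectionsOf (derived p m e n (k + 1)) x := by
  induction k with
  | zero => exact hG n x
  | succ k ih => exact commutator_le_sectionsOf ih

theorem derived_apply_eq : {n : ℕ} → (v : Vertex (deg p m) n) → (k : ℕ) → len v ≤ k →
    ∀ g ∈ derived p m e n k, g v = v
  | _, root, _, _, g, _ => map_root g
  | _, cons _ _, 0, h, _, _ => absurd h (Nat.not_succ_le_zero _)
  | n, cons x v, k + 1, h, g, hg => by
      obtain ⟨s, hs, hgs⟩ := derived_le_withSections n k hg x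
      rw [hgs, derived_apply_eq v k (Nat.le_of_succ_le_succ h) s hs]
      rfl

/-- Correct the tail by a commutator that fixes the first letter, then rotate that letter by a power
of `a`. -/
theorem transitive_G (hd : ∀ n, 2 ≤ deg p m n)
    (hG : ∀ n x, G p m e (n + 1) ≤ sectionsOf ⁅G p m e n, G p m e n⁆ x) :
    {n : ℕ} → (w w' : Vertex (deg p m) n) → len w = len w' → ∃ g ∈ G p m e n, g w = w'
  | _, root, root, _ => ⟨1, one_mem _, rfl⟩
  | _, root, cons _ _, h => absurd h (Nat.succ_ne_zero _).symm
  | _, cons _ _, root, h => absurd h (Nat.succ_ne_zero _)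
  | n, cons x w, cons y w', h => by
      obtain ⟨i, hi⟩ := exists_finRotate_zpow_apply _ (hd n) x y
      obtain ⟨s, hs, hsw⟩ := transitive_G hd hG w w' (Nat.succ.inj h)
      obtain ⟨g, hg, hgs⟩ := hG n x hs
      refine ⟨a p m n ^ i * g, mul_mem (zpow_mem (a_mem n) i) (Subgroup.commutator_le_self _ hg), ?_⟩
      rw [AutTree.mul_apply, hgs, a_zpow_cons, hi, hsw]

theorem transitive_derived (hd : ∀ n, 2 ≤ deg p m n)
    (hG : ∀ n x, G p m e (n + 1) ≤ sectionsOf ⁅G p m e n, G p m e n⁆ x) :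
    {n : ℕ} → (v w w' : Vertex (deg p m) n) → v ≤ w → v ≤ w' → len w = len w' →
      ∃ g ∈ derived p m e n (len v), g w = w'
  | _, root, w, w', _, _, h => transitive_G hd hG w w' h
  | _, cons _ _, root, _, hv, _, _ => absurd hv cons_le_root
  | _, cons _ _, cons _ _, root, _, hv, _ => absurd hv cons_le_root
  | n, cons x v, cons y w, cons z w', hv, hv', h => by
      obtain ⟨rfl, hvw⟩ := cons_le_cons.1 hv
      obtain ⟨rfl, hvw'⟩ := cons_le_cons.1 hv'
      obtain ⟨s, hs, hsw⟩ := transitive_derived hd hG v w w' hvw hvw' (Nat.succ.inj h)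
      obtain ⟨g, hg, hgs⟩ := derived_le_sectionsOf hG n (len v) x hs
      exact ⟨g, hg, by rw [hgs, hsw]⟩

theorem exists_mem_derived_ne_one (hd : ∀ n, 2 ≤ deg p m n)
    (hG : ∀ n x, G p m e (n + 1) ≤ sectionsOf ⁅G p m e n, G p m e n⁆ x) (k : ℕ) :
    ∀ n, ∃ g ∈ derived p m e n k, g ≠ 1 := by
  induction k with
  | zero =>
    intro n
    have hpos : 0 < deg p m n := by have := hd n; omega
    obtain ⟨g, hg, hgx⟩ := transitive_G hd hG
      (cons ⟨0, hpos⟩ root : Vertex (deg p m) n) (cons ⟨1, hd n⟩ root) rfl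
    refine ⟨g, hg, ?_⟩
    rintro rfl
    have := (cons.inj hgx).1
    simp at this
  | succ k ih =>
    intro n
    have hpos : 0 < deg p m n := by have := hd n; omega
    obtain ⟨s, hs, hs1⟩ := ih (n + 1)
    obtain ⟨g, hg, hgs⟩ := derived_le_sectionsOf hG n k ⟨0, hpos⟩ hs
    refine ⟨g, hg, ?_⟩
    rintro rfl
    exact hs1 (RelIso.ext fun u => ((cons.inj (hgs u)).2).symm)

/-- Branching is the case `k = 0`, whence the index `k + 1`. As `insertAt x` is a homomorphism,
further derivation preserves the inclusion without shifting the index. -/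
theorem insertAt_mem_derived
    (hbranch : ∀ n : ℕ,
      Subgroup.pi Set.univ (fun _ => ⁅G p m e (n + 1), G p m e (n + 1)⁆) ≤
        (⁅G p m e n, G p m e n⁆.subgroupOf (levelStab (deg p m) n)).map
          (psi (deg p m) n).toMonoidHom)
    (n k : ℕ) (x : Fin (deg p m n)) :
    (derived p m e (n + 1) (k + 1)).map (insertAt x) ≤ derived p m e n (k + 1) := by
  induction k with
  | zero =>
    rintro _ ⟨g, hg, rfl⟩
    obtain ⟨f, hf, hfg⟩ := hbranch n
      (Subgroup.mulSingle_mem_pi (x := g) x |>.2 fun _ => hg)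
    have : insertAt x g = f.1 := by
      change ((psi (deg p m) n).symm (Pi.mulSingle x g)).1 = f.1
      rw [← hfg]
      exact congrArg Subtype.val ((psi (deg p m) n).symm_apply_apply f)
    rw [this]
    exact hf
  | succ k ih =>
    rw [derived, derived, iterDerived, Subgroup.map_commutator]
    exact Subgroup.commutator_mono ih ih

theorem exists_mem_rist
    (hd : ∀ n, 2 ≤ deg p m n)
    (hG : ∀ n x, G p m e (n + 1) ≤ sectionsOf ⁅G p m e n, G p m e n⁆ x)
    (hins : ∀ n k x, (derived p m e (n + 1) (k + 1)).map (insertAt x) ≤ derived p m e n (k + 1))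
    (k : ℕ) : {n : ℕ} → (v : Vertex (deg p m) n) →
      ∃ g ∈ derived p m e n (k + 1), g ≠ 1 ∧ g ∈ rist v
  | n, root => by
      obtain ⟨g, hg, hg1⟩ := exists_mem_derived_ne_one hd hG (k + 1) n
      exact ⟨g, hg, hg1, fun u hu => absurd (root_le u) hu⟩
  | n, cons x v => by
      obtain ⟨g, hg, hg1, hgv⟩ := exists_mem_rist hd hG hins k v
      refine ⟨insertAt x g, hins n k x ⟨g, hg, rfl⟩, fun h => hg1 ?_, insertAt_mem_rist hgv⟩
      exact insertAt_injective x (h.trans (map_one _).symm)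

theorem mem_derivedSeries_iff {n k : ℕ} {g : G p m e n} :
    g ∈ derivedSeries (G p m e n) k ↔ g.1 ∈ derived p m e n k := by
  rw [derived, ← map_subtype_derivedSeries]
  exact (Subgroup.mem_map_iff_mem (G p m e n).subtype_injective).symm

theorem derived_le_G (n k : ℕ) : derived p m e n k ≤ G p m e n := by
  rw [derived, ← map_subtype_derivedSeries]
  exact Subgroup.map_subtype_le _

/-- The derived series of a growing GGS-group is saturated. -/
theorem isSaturated_derivedSeries (hd : ∀ n, 2 ≤ deg p m n)
    (hG : ∀ n x, G p m e (n + 1) ≤ sectionsOf ⁅G p m e n, G p m e n⁆ x)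
    (hins : ∀ n k x, (derived p m e (n + 1) (k + 1)).map (insertAt x) ≤ derived p m e n (k + 1)) :
    IsSaturated (G p m e 0) (derivedSeries (G p m e 0)) where
  characteristic := fun _ => inferInstance
  antitone := derivedSeries_antitone _
  fix := fun k g hg v hv => derived_apply_eq v k hv g.1 (mem_derivedSeries_iff.1 hg)
  transitive := fun v w w' hw hw' h => by
    obtain ⟨g, hg, hgw⟩ := transitive_derived hd hG v w w' hw hw' h
    exact ⟨⟨g, derived_le_G _ _ hg⟩, mem_derivedSeries_iff.2 hg, hgw⟩
  exists_rist := fun v => by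
    -- This element lies one derived step deeper than needed, since branching starts at the derived
    -- subgroup; the series is decreasing.
    obtain ⟨g, hg, hg1, hgv⟩ := exists_mem_rist hd hG hins (len v) v
    exact ⟨⟨g, derived_le_G _ _ hg⟩, mem_derivedSeries_iff.2 (iterDerived_succ_le _ _ hg),
      fun h => hg1 (congrArg Subtype.val h), hgv⟩

end GrowingGGS

theorem mainTheorem9 (p : ℕ) (hp : p.Prime) (hp2 : p ≠ 2)
    (m : ℕ → ℕ) (hm0 : 0 < m 0) (hm : StrictMono m)
    (e : Fin (p ^ m 0 - 1) → ℤ) (he : ∀ i, |e i| ≤ (p : ℤ) ^ m 1 - 1)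
    (heF : ∃ i, ¬ e i ≡ 0 [ZMOD p])
    (henc : ∃ i j, ¬ e i ≡ e j [ZMOD p])
    (hbranch : ∀ n : ℕ,
      Subgroup.pi Set.univ
          (fun _ => ⁅GrowingGGS.G p m e (n + 1), GrowingGGS.G p m e (n + 1)⁆) ≤
        (⁅GrowingGGS.G p m e n, GrowingGGS.G p m e n⁆.subgroupOf
            (AutTree.levelStab (GrowingGGS.deg p m) n)).map
          (AutTree.psi (GrowingGGS.deg p m) n).toMonoidHom) :
    Function.Bijective (GrowingGGS.G p m e 0).normalizerMonoidHom := by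
  have hd := GrowingGGS.two_le_deg hp hm0 hm
  exact (GrowingGGS.isSaturated_derivedSeries hd (GrowingGGS.G_le_sectionsOf hp hm0 hm henc)
    (GrowingGGS.insertAt_mem_derived hbranch)).bijective_normalizerMonoidHom
      fun n => Nat.zero_lt_of_lt (hd n)
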